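/- **Setting.** Let $n\ge 3$, $0<X_A\le X_B$, $\alpha\in[0,1]$, and $w^A_i,w^B_i>0$ for $i\in[n]=\{1,\dots,n\}$. In the Generalized Colonel Blotto game with these parameters, a pure strategy of player $P\in\{A,B\}$ is a vector $x\in\mathbb{R}^n_{\ge 0}$ with $\sum_i x_i\le X_P$. The payoffs are $\Pi_A(x^A,x^B)=\sum_i w^A_i\beta_A(x^A_i,x^B_i)$ and $\Pi_B(x^A,x^B)=\sum_i w^B_i\beta_B(x^A_i,x^B_i)$. Here $\beta_A(x,y)$ equals $1$ if $x>y$, $\alpha$ if $x=y$ and $0$ if $x<y$, and $\beta_B=1-\beta_A$. For mixed strategies (probability distributions on pure strategies, drawn independently by the two players), $\Pi_A$ and $\Pi_B$ denote expected payoffs. Put $W_P=\sum_i w^P_i$ and $v^P_i=w^P_i/W_P$. For $\gamma>0$ let $\Omega(\gamma)=\{i\in[n]: v^A_i/v^B_i>\gamma\}$, and let $\mathcal S$ be the set of all $\gamma>0$ with $$\frac{X_B\gamma}{X_A}=\frac{\gamma^2\sum_{i\in\Omega(\gamma)}\frac{(v^B_i)^2}{v^A_i}+\sum_{i\notin\Omega(\gamma)}v^A_i}{\sum_{i\in\Omega(\gamma)}v^B_i+\frac1{\gamma^2}\sum_{i\notin\Omega(\gamma)}\frac{(v^A_i)^2}{v^B_i}}.$$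 For $\gamma^*\in\mathcal S$ put $$\lambda_A=\frac{(\gamma^*)^2}{2X_B}\sum_{i\in\Omega(\gamma^*)}\frac{(v^B_i)^2}{v^A_i}+\frac1{2X_B}\sum_{i\notin\Omega(\gamma^*)}v^A_i,\qquad \lambda_B=\frac1{2X_A}\sum_{i\in\Omega(\gamma^*)}v^B_i+\frac1{2(\gamma^*)^2X_A}\sum_{i\notin\Omega(\gamma^*)}\frac{(v^A_i)^2}{v^B_i},$$ and $s_i=v^A_i/\lambda_A$, $t_i=v^B_i/\lambda_B$. If $i\in\Omega(\gamma^*)$, let $F_{A^*_i}$ be the uniform distribution on $[0,t_i]$, and let $F_{B^*_i}$ put mass $(s_i-t_i)/s_i$ at $0$ and spread the remaining mass uniformly on $[0,t_i]$. If $i\notin\Omega(\gamma^*)$, let $F_{A^*_i}$ put mass $(t_i-s_i)/t_i$ at $0$ and spread the remaining mass uniformly on $[0,s_i]$, and let $F_{B^*_i}$ be the uniform distribution on $[0,s_i]$. The strategy $\mathrm{IU}^{\gamma^*}_A$ is the law of the following random allocation: draw $a_i\sim F_{A^*_i}$, $i\in[n]$, independently, and allocate $x_i=X_A\,a_i/\sum_j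 a_j$ for all $i$, or $x_i=0$ for all $i$ if $\sum_j a_j=0$. The strategy $\mathrm{IU}^{\gamma^*}_B$ is defined in the same way from the $F_{B^*_i}$ and $X_B$. For $\varepsilon>0$, consider for $\gamma^*\in\mathcal S$ and pure strategies $x^A$, $x^B$ of the two players the inequalities $$\Pi_A(x^A,\mathrm{IU}^{\gamma^*}_B)\le\Pi_A(\mathrm{IU}^{\gamma^*}_A,\mathrm{IU}^{\gamma^*}_B)+\varepsilon W_A,\qquad \Pi_B(\mathrm{IU}^{\gamma^*}_A,x^B)\le\Pi_B(\mathrm{IU}^{\gamma^*}_A,\mathrm{IU}^{\gamma^*}_B)+\varepsilon W_B.\qquad(\ast)$$ **Theorem.** Let $0<X_A\le X_B$ and $0<\underline w\le\overline w$ be given. (i) There is a function $n\mapsto\varepsilon(n)>0$, depending only on $X_A,X_B,\underline w,\overline w$, with $\varepsilon(n)=\tilde{\mathcal O}(n^{-1/2})$ (that is, $\varepsilon(n)=\mathcal O(n^{-1/2}(\ln n)^k)$ as $n\to\infty$ for some $k\in\mathbb N$), such that in every game as above with $n\ge 3$ battlefields, any $\alpha\in[0,1]$, and all values $w^A_i,w^B_i\in[\underline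 w,\overline w]$, $(\ast)$ holds with $\varepsilon=\varepsilon(n)$ for all $\gamma^*\in\mathcal S$ and all pure strategies $x^A,x^B$ of $A$ and $B$. (ii) There is a constant $C^*>0$, depending only on $X_A,X_B,\underline w,\overline w$, such that for every $\varepsilon\in(0,1]$ and every game as above with any $\alpha\in[0,1]$, all values $w^A_i,w^B_i\in[\underline w,\overline w]$, and $$n\ge C^*\varepsilon^{-2}\max\{1,\ln(\varepsilon^{-1})\},$$ $(\ast)$ holds for all $\gamma^*\in\mathcal S$ and all pure strategies $x^A,x^B$ of $A$ and $B$. -/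

import Mathlib

open MeasureTheory

noncomputable section

/-- A Generalized Colonel Blotto game with `n` battlefields and budgets `XA ≤ XB`: the values
`wA i`, `wB i > 0` that the two players give to battlefield `i`, and the tie-breaking
parameter `α ∈ [0, 1]`. -/
structure GCBGame (n : ℕ) (XA XB : ℝ) where
  wA : Fin n → ℝ
  wB : Fin n → ℝ
  α : ℝ
  three_le : 3 ≤ n
  XA_pos : 0 < XA
  XA_le_XB : XA ≤ XB
  wA_pos : ∀ i, 0 < wA i
  wB_pos : ∀ i, 0 < wB i
  α_nonneg : 0 ≤ α
  α_le_one : α ≤ 1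

/-- The pure strategies of a player with budget `X`: nonnegative allocations of total at
most `X`. -/
def pureStrategies (n : ℕ) (X : ℝ) : Set (Fin n → ℝ) :=
  {x | (∀ i, 0 ≤ x i) ∧ ∑ i, x i ≤ X}

/-- The Blotto function of player A, with tie-breaking parameter `α`. -/
def blottoA (α x y : ℝ) : ℝ := if y < x then 1 else if x = y then α else 0

/-- The Blotto function of player B, with tie-breaking parameter `α`. -/
def blottoB (α x y : ℝ) : ℝ := if x < y then 1 else if y = x then 1 - α else 0

/-- The uniform-type distribution with mass `p` at `0`, the remaining mass `1 - p` being spread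
uniformly over `[0, b]`. -/
def uniformType (p b : ℝ) : Measure ℝ :=
  ENNReal.ofReal p • Measure.dirac 0 +
    ENNReal.ofReal (1 - p) • ProbabilityTheory.cond volume (Set.Icc 0 b)

/-- Rescaling of a vector of draws so that its total is the budget `X`; the zero allocation is
returned if the draws sum to `0`. -/
def rescale {n : ℕ} (X : ℝ) (a : Fin n → ℝ) : Fin n → ℝ :=
  if ∑ j, a j = 0 then fun _ => 0 else fun i => a i / (∑ j, a j) * X

theorem measurable_rescale {n : ℕ} (X : ℝ) : Measurable (rescale (n := n) X) := by
  have hs : Measurable fun a : Fin n → ℝ => ∑ j, a j :=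
    Finset.measurable_sum _ fun j _ => measurable_pi_apply j
  refine Measurable.ite (measurableSet_eq_fun hs measurable_const) measurable_const ?_
  exact measurable_pi_lambda _ fun i => ((measurable_pi_apply i).div hs).mul_const X

/-- `f = Õ(g)` as functions of `n`: `f = O(g)` up to a power of `log n`. -/
def IsSoftO (f g : ℕ → ℝ) : Prop :=
  ∃ k : ℕ, Asymptotics.IsBigO Filter.atTop f fun n => g n * Real.log n ^ k

namespace GCBGame

variable {n : ℕ} {XA XB : ℝ} (G : GCBGame n XA XB)

/-- The total value of the battlefields for player A. -/
def totalA : ℝ := ∑ i, G.wA i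

/-- The total value of the battlefields for player B. -/
def totalB : ℝ := ∑ i, G.wB i

/-- The normalized values for player A. -/
def vA (i : Fin n) : ℝ := G.wA i / G.totalA

/-- The normalized values for player B. -/
def vB (i : Fin n) : ℝ := G.wB i / G.totalB

/-- All battlefield values lie between `wlo` and `whi`. -/
def ValuesWithin (wlo whi : ℝ) : Prop :=
  ∀ i, (wlo ≤ G.wA i ∧ G.wA i ≤ whi) ∧ (wlo ≤ G.wB i ∧ G.wB i ≤ whi)

/-- Payoff of player A at a pure strategy profile. -/
def payoffA (x y : Fin n → ℝ) : ℝ := ∑ i, G.wA i * blottoA G.α (x i) (y i)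

/-- Payoff of player B at a pure strategy profile. -/
def payoffB (x y : Fin n → ℝ) : ℝ := ∑ i, G.wB i * blottoB G.α (x i) (y i)

/-- Expected payoff of player A when A and B independently draw their allocations from the mixed
strategies `s` and `t`. -/
def expPayoffA (s t : Measure (Fin n → ℝ)) : ℝ := ∫ z, G.payoffA z.1 z.2 ∂(s.prod t)

/-- Expected payoff of player B when A and B independently draw their allocations from the mixed
strategies `s` and `t`. -/
def expPayoffB (s t : Measure (Fin n → ℝ)) : ℝ := ∫ z, G.payoffB z.1 z.2 ∂(s.prod t)

/-- The battlefields on which `vA i / vB i > γ`. -/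
def Omega (γ : ℝ) : Finset (Fin n) := Finset.univ.filter fun i => G.vA i / G.vB i > γ

/-- The positive solutions `γ` of the equation that determines the uniform-type distributions. -/
def solutions : Set ℝ :=
  {γ | 0 < γ ∧
    XB * γ / XA =
      (γ ^ 2 * ∑ i ∈ G.Omega γ, G.vB i ^ 2 / G.vA i + ∑ i ∈ (G.Omega γ)ᶜ, G.vA i) /
        (∑ i ∈ G.Omega γ, G.vB i + 1 / γ ^ 2 * ∑ i ∈ (G.Omega γ)ᶜ, G.vA i ^ 2 / G.vB i)}

/-- The multiplier `λ_A` attached to `γ`. -/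
def lambdaA (γ : ℝ) : ℝ :=
  γ ^ 2 / (2 * XB) * ∑ i ∈ G.Omega γ, G.vB i ^ 2 / G.vA i +
    1 / (2 * XB) * ∑ i ∈ (G.Omega γ)ᶜ, G.vA i

/-- The multiplier `λ_B` attached to `γ`. -/
def lambdaB (γ : ℝ) : ℝ :=
  1 / (2 * XA) * ∑ i ∈ G.Omega γ, G.vB i +
    1 / (2 * γ ^ 2 * XA) * ∑ i ∈ (G.Omega γ)ᶜ, G.vA i ^ 2 / G.vB i

/-- The uniform-type distribution of player A on battlefield `i`: uniform on `[0, vB i / λ_B]`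
where A is strong, and an atom at `0` plus a uniform part on `[0, vA i / λ_A]` where A is weak. -/
def distA (γ : ℝ) (i : Fin n) : Measure ℝ :=
  if i ∈ G.Omega γ then
    uniformType 0 (G.vB i / G.lambdaB γ)
  else
    uniformType
      ((G.vB i / G.lambdaB γ - G.vA i / G.lambdaA γ) / (G.vB i / G.lambdaB γ))
      (G.vA i / G.lambdaA γ)

/-- The uniform-type distribution of player B on battlefield `i`: uniform on `[0, vA i / λ_A]`
where B is strong, and an atom at `0` plus a uniform part on `[0, vB i / λ_B]` where B is weak. -/
def distB (γ : ℝ) (i : Fin n) : Measure ℝ :=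
  if i ∈ G.Omega γ then
    uniformType
      ((G.vA i / G.lambdaA γ - G.vB i / G.lambdaB γ) / (G.vA i / G.lambdaA γ))
      (G.vB i / G.lambdaB γ)
  else
    uniformType 0 (G.vA i / G.lambdaA γ)

/-- The independently uniform strategy of player A: the law of the rescaled independent draws. -/
def IUA (γ : ℝ) : Measure (Fin n → ℝ) := (Measure.pi (G.distA γ)).map (rescale XA)

/-- The independently uniform strategy of player B: the law of the rescaled independent draws. -/
def IUB (γ : ℝ) : Measure (Fin n → ℝ) := (Measure.pi (G.distB γ)).map (rescale XB)

/-- For every solution `γ`, no pure deviation from the independently uniform profile gains more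
than `ε * totalA` for player A or more than `ε * totalB` for player B. -/
def NoLargeGain (ε : ℝ) : Prop :=
  ∀ γ ∈ G.solutions,
    (∀ x ∈ pureStrategies n XA,
      G.expPayoffA (Measure.dirac x) (G.IUB γ) ≤
        G.expPayoffA (G.IUA γ) (G.IUB γ) + ε * G.totalA) ∧
    (∀ y ∈ pureStrategies n XB,
      G.expPayoffB (G.IUA γ) (Measure.dirac y) ≤
        G.expPayoffB (G.IUA γ) (G.IUB γ) + ε * G.totalB)

end GCBGame

end

/-! On battlefield `i` both players' draws live on a common interval `[0, b i]`, where `b i` is the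
smaller of `s i` and `t i`, and at most one of them has an atom at `0`. If the opponent's atom is `q
i`, an amount `z` beats the opponent's draw with probability at most `q i + (1 - q i) / b i * z`,
with essentially equality for `z ≤ b i`. The multipliers make `w i * (1 - q i) / b i` a constant
`l`, so against the unscaled draws an allocation `x` wins at most `∑ w i * q i + l * ∑ x i`. Only
the total spent matters, hence at most `∑ w i * q i + l * X`. The player's own draws have mean total
`X` and attain this bound.

Rescaling is the only source of error. The draws are independent and bounded by `K / n`, so by
Hoeffding each total is within relative error `η` of its budget, except with probability at most `2
* exp (-(2 * n * (η * XA) ^ 2 / K ^ 2))`. Outside these events rescaling distorts allocations by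
factors `1 + O(η)`. Comparing `integral_wonValue_rescale_le` with `le_integral_wonValue_rescale`
bounds the relative gain by `2 * η + 3 * τ`, where `τ` bounds both failure probabilities.
`endpoint_le` makes `K` independent of `n` and of the solution `γ`. It remains to choose `η`: of
order `√(log n / n)` for the rate, `ε / 4` for the threshold.

Ties count as wins in the upper bound and as losses in the lower one, so the tie-breaking parameter
never matters. Player B's case is the same argument with the roles exchanged. -/

/-! ### Uniform-type distributions: mean and distribution function. -/

theorem isProbabilityMeasure_cond_Icc {b : ℝ} (hb : 0 < b) :
    IsProbabilityMeasure (ProbabilityTheory.cond volume (Set.Icc 0 b)) :=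
  ProbabilityTheory.cond_isProbabilityMeasure_of_finite (by simp [hb]) (by simp)

theorem uniformType_isProbabilityMeasure {p b : ℝ} (hp0 : 0 ≤ p) (hp1 : p ≤ 1) (hb : 0 < b) :
    IsProbabilityMeasure (uniformType p b) := by
  have := isProbabilityMeasure_cond_Icc hb
  constructor
  simp only [uniformType, Measure.add_apply, Measure.smul_apply, measure_univ, smul_eq_mul, mul_one]
  rw [← ENNReal.ofReal_add hp0 (by linarith)]
  simp

theorem uniformType_real_apply {p b : ℝ} (hp0 : 0 ≤ p) (hp1 : p ≤ 1) (s : Set ℝ) :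
    (uniformType p b).real s = p * (Measure.dirac (0 : ℝ)).real s +
      (1 - p) * (ProbabilityTheory.cond volume (Set.Icc 0 b)).real s := by
  have h1 : 0 ≤ 1 - p := by linarith
  simp only [uniformType, measureReal_def, Measure.add_apply, Measure.smul_apply, smul_eq_mul]
  rw [ENNReal.toReal_add (ENNReal.mul_ne_top ENNReal.ofReal_ne_top (measure_ne_top _ _))
    (ENNReal.mul_ne_top ENNReal.ofReal_ne_top (measure_ne_top _ _)), ENNReal.toReal_mul,
    ENNReal.toReal_mul, ENNReal.toReal_ofReal hp0, ENNReal.toReal_ofReal h1]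

theorem cond_Icc_real_apply {b : ℝ} (hb : 0 < b) (s : Set ℝ) :
    (ProbabilityTheory.cond volume (Set.Icc 0 b)).real s =
      b⁻¹ * (volume (α := ℝ)).real (Set.Icc 0 b ∩ s) := by
  rw [measureReal_def, ProbabilityTheory.cond_apply measurableSet_Icc, ENNReal.toReal_mul,
    ENNReal.toReal_inv, measureReal_def]
  simp [hb.le]

theorem uniformType_ae_mem_Icc {p b : ℝ} (hb : 0 < b) :
    ∀ᵐ x ∂(uniformType p b), x ∈ Set.Icc 0 b := by
  rw [uniformType, ae_add_measure_iff]
  refine ⟨Measure.ae_smul_measure ?_ _, Measure.ae_smul_measure ?_ _⟩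
  · rw [ae_dirac_eq]; exact ⟨le_rfl, hb.le⟩
  · exact ProbabilityTheory.ae_cond_mem measurableSet_Icc

theorem uniformType_zero_ae_pos {b : ℝ} : ∀ᵐ x ∂(uniformType 0 b), 0 < x := by
  have h : ∀ᵐ x ∂(ProbabilityTheory.cond volume (Set.Icc 0 b)), x ≠ 0 :=
    ProbabilityTheory.cond_absolutelyContinuous.ae_le (Measure.ae_ne volume 0)
  simp only [uniformType, ENNReal.ofReal_zero, zero_smul, zero_add, sub_zero, ENNReal.ofReal_one,
    one_smul]
  filter_upwards [h, ProbabilityTheory.ae_cond_mem measurableSet_Icc] with x hx hx'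
  exact lt_of_le_of_ne hx'.1 (Ne.symm hx)

theorem integral_id_uniformType {p b : ℝ} (hp1 : p ≤ 1) (hb : 0 < b) :
    ∫ x, x ∂(uniformType p b) = (1 - p) * b / 2 := by
  have hc : ∫ x, x ∂(ProbabilityTheory.cond volume (Set.Icc 0 b)) = b / 2 := by
    rw [ProbabilityTheory.cond, integral_smul_measure, integral_Icc_eq_integral_Ioc,
      ← intervalIntegral.integral_of_le hb.le, integral_id]
    simp [hb.le]
    field_simp
  have := isProbabilityMeasure_cond_Icc hb
  have hi : Integrable (fun x : ℝ => x) (ProbabilityTheory.cond volume (Set.Icc 0 b)) :=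
    Integrable.of_mem_Icc 0 b aemeasurable_id (ProbabilityTheory.ae_cond_mem measurableSet_Icc)
  rw [uniformType, integral_add_measure, integral_smul_measure, integral_smul_measure, hc,
    ENNReal.toReal_ofReal (by linarith : 0 ≤ 1 - p)]
  · simp; ring
  · exact (integrable_dirac (by simp)).smul_measure ENNReal.ofReal_ne_top
  · exact hi.smul_measure ENNReal.ofReal_ne_top

theorem integrable_id_uniformType {p b : ℝ} (hp0 : 0 ≤ p) (hp1 : p ≤ 1) (hb : 0 < b) :
    Integrable (fun x => x) (uniformType p b) :=
  have := uniformType_isProbabilityMeasure hp0 hp1 hb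
  Integrable.of_mem_Icc 0 b aemeasurable_id (uniformType_ae_mem_Icc hb)

/-- The distribution function is this affine function capped at `1`, so no bound `z ≤ b` is needed
in this direction. The closed half-line lets ties count as wins. -/
theorem uniformType_real_Iic_le {p b z : ℝ} (hp0 : 0 ≤ p) (hp1 : p ≤ 1) (hb : 0 < b)
    (hz : 0 ≤ z) : (uniformType p b).real (Set.Iic z) ≤ p + (1 - p) / b * z := by
  have h1 : (Measure.dirac (0 : ℝ)).real (Set.Iic z) ≤ 1 := measureReal_le_one
  have h2 : (volume (α := ℝ)).real (Set.Icc 0 b ∩ Set.Iic z) ≤ z := by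
    calc _ ≤ (volume (α := ℝ)).real (Set.Icc 0 z) :=
          measureReal_mono (fun x hx => ⟨hx.1.1, hx.2⟩) (by simp)
      _ = z := by simp [hz]
  rw [uniformType_real_apply hp0 hp1, cond_Icc_real_apply hb]
  have : (1 - p) * (b⁻¹ * (volume (α := ℝ)).real (Set.Icc 0 b ∩ Set.Iic z)) ≤ (1 - p) / b * z := by
    rw [← mul_assoc, ← div_eq_mul_inv]
    exact mul_le_mul_of_nonneg_left h2 (div_nonneg (by linarith) hb.le)
  nlinarith

/-- The open half-line lets ties count as losses. It misses the atom when `z = 0`, hence the last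
hypothesis. -/
theorem le_uniformType_real_Iio {p b z : ℝ} (hp0 : 0 ≤ p) (hp1 : p ≤ 1) (hb : 0 < b)
    (hz : 0 ≤ z) (hzb : z ≤ b) (hzp : 0 < z ∨ p = 0) :
    p + (1 - p) / b * z ≤ (uniformType p b).real (Set.Iio z) := by
  have h1 : p ≤ p * (Measure.dirac (0 : ℝ)).real (Set.Iio z) := by
    rcases hzp with h | h
    · simp [measureReal_def, h]
    · simp [h]
  have h2 : z ≤ (volume (α := ℝ)).real (Set.Icc 0 b ∩ Set.Iio z) := by
    calc z = (volume (α := ℝ)).real (Set.Ico 0 z) := by simp [hz]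
      _ ≤ _ := measureReal_mono (fun x hx => (⟨⟨hx.1, hx.2.le.trans hzb⟩, hx.2⟩ :
          x ∈ Set.Icc 0 b ∩ Set.Iio z)) (measure_ne_top_of_subset Set.inter_subset_left (by simp))
  rw [uniformType_real_apply hp0 hp1, cond_Icc_real_apply hb]
  have : (1 - p) / b * z ≤ (1 - p) * (b⁻¹ * (volume (α := ℝ)).real (Set.Icc 0 b ∩ Set.Iio z)) := by
    rw [← mul_assoc, ← div_eq_mul_inv]
    exact mul_le_mul_of_nonneg_left h2 (div_nonneg (by linarith) hb.le)
  linarith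

/-- If at most one of two independent uniform-type draws on the same interval has an atom, the
second is less than `c` times the first with at least the probability given by the means. -/
theorem le_prod_uniformType_real_lt {p q b c : ℝ} (hp0 : 0 ≤ p) (hp1 : p ≤ 1) (hq0 : 0 ≤ q)
    (hq1 : q ≤ 1) (hpq : p = 0 ∨ q = 0) (hb : 0 < b) (hc0 : 0 < c) (hc1 : c ≤ 1) :
    q + (1 - q) / b * (c * ((1 - p) * b / 2)) ≤
      ((uniformType p b).prod (uniformType q b)).real {z | z.2 < c * z.1} := by
  have := uniformType_isProbabilityMeasure hp0 hp1 hb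
  have := uniformType_isProbabilityMeasure hq0 hq1 hb
  have hm : MeasurableSet {z : ℝ × ℝ | z.2 < c * z.1} :=
    measurableSet_lt measurable_snd (measurable_fst.const_mul c)
  -- The affine lower bound fails only at `a = 0` with `q > 0`; in that case `p = 0` and the first
  -- draw is almost surely positive.
  have hpos : ∀ᵐ a ∂(uniformType p b), 0 < a ∨ q = 0 := by
    rcases hpq with rfl | h
    · filter_upwards [uniformType_zero_ae_pos] with a ha using Or.inl ha
    · exact Filter.Eventually.of_forall fun a => Or.inr h
  have hmeas := measurable_measure_prodMk_left (ν := uniformType q b) hm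
  rw [← integral_indicator_one hm, integral_prod _
    ((integrable_const _).indicator hm), ← integral_id_uniformType hp1 hb]
  have e : ∀ a : ℝ, (∫ y, {z : ℝ × ℝ | z.2 < c * z.1}.indicator 1 (a, y) ∂(uniformType q b) : ℝ) =
      (uniformType q b).real (Set.Iio (c * a)) := fun a => by
    rw [← integral_indicator_one measurableSet_Iio]; rfl
  simp only [e]
  -- The conditional probability given the first draw `a` is bounded below by an affine function of
  -- `a`, so only the mean of `a` enters; `c ≤ 1` keeps `c * a` in `[0, b]`.
  calc _ = ∫ a, (q + (1 - q) / b * (c * a)) ∂(uniformType p b) := by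
        have hi := integrable_id_uniformType hp0 hp1 hb
        rw [integral_add (integrable_const _) ((hi.const_mul c).const_mul _), integral_const_mul,
          integral_const_mul]
        simp
    _ ≤ _ := by
        have hi := integrable_id_uniformType hp0 hp1 hb
        refine integral_mono_ae ((integrable_const _).add ((hi.const_mul c).const_mul _)) ?_ ?_
        · refine Integrable.of_mem_Icc 0 1 hmeas.ennreal_toReal.aemeasurable
            (Filter.Eventually.of_forall fun a => ⟨measureReal_nonneg, measureReal_le_one⟩)
        · filter_upwards [uniformType_ae_mem_Icc hb, hpos] with a ha hap
          refine le_uniformType_real_Iio hq0 hq1 hb (mul_nonneg hc0.le ha.1) ?_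
            (hap.imp_left fun h => mul_pos hc0 h)
          nlinarith [ha.1, ha.2]

/-! ### Concentration of the total of the draws. -/

theorem ae_pi_eval {ι : Type*} [Fintype ι] {μ : ι → Measure ℝ} [∀ i, IsProbabilityMeasure (μ i)]
    (i : ι) {P : ℝ → Prop} (h : ∀ᵐ x ∂(μ i), P x) : ∀ᵐ a ∂(Measure.pi μ), P (a i) :=
  (measurePreserving_eval μ i).quasiMeasurePreserving.ae h

/-- Hoeffding's inequality for the total of independent uniform-type draws. -/
theorem pi_uniformType_real_abs_sum_sub_ge {n : ℕ} (hn : 0 < n) {p b : Fin n → ℝ} {K X δ : ℝ}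
    (hp0 : ∀ i, 0 ≤ p i) (hp1 : ∀ i, p i ≤ 1) (hb : ∀ i, 0 < b i) (hbK : ∀ i, b i ≤ K / n)
    (hX : ∑ i, (1 - p i) * b i / 2 = X) (hδ : 0 ≤ δ) :
    (Measure.pi fun i => uniformType (p i) (b i)).real {a | δ ≤ |∑ i, a i - X|} ≤
      2 * Real.exp (-(2 * n * δ ^ 2 / K ^ 2)) := by
  have hU := fun i => uniformType_isProbabilityMeasure (hp0 i) (hp1 i) (hb i)
  set P := Measure.pi fun i => uniformType (p i) (b i)
  have hn' : (0 : ℝ) < n := by exact_mod_cast hn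
  have hK : 0 < K := by
    have := (hb ⟨0, hn⟩).trans_le (hbK ⟨0, hn⟩)
    rwa [div_pos_iff_of_pos_right hn'] at this
  have hmean : ∀ i, ∫ a, a i ∂P = (1 - p i) * b i / 2 := fun i => by
    rw [← integral_id_uniformType (hp1 i) (hb i)]
    exact integral_comp_eval (μ := fun i => uniformType (p i) (b i)) (i := i) (f := fun x => x)
      aestronglyMeasurable_id
  have hsub : ∀ i, ProbabilityTheory.HasSubgaussianMGF (fun a : Fin n → ℝ =>
      a i - (1 - p i) * b i / 2) ((‖b i‖₊ / 2) ^ 2) P := fun i => by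
    have := ProbabilityTheory.hasSubgaussianMGF_of_mem_Icc (μ := P) (X := fun a => a i)
      (measurable_pi_apply i).aemeasurable (ae_pi_eval i (uniformType_ae_mem_Icc (hb i)))
    rwa [hmean, sub_zero] at this
  -- A variable in `[0, b i]` has sub-Gaussian parameter `(b i / 2) ^ 2`; with `b i ≤ K / n` the `n`
  -- parameters add up to order `1 / n`.
  have hc : ((∑ i, (‖b i‖₊ / 2) ^ 2 : NNReal) : ℝ) ≤ K ^ 2 / (4 * n) := by
    push_cast
    calc ∑ i, (‖b i‖ / 2) ^ 2 ≤ ∑ _i : Fin n, (K / n / 2) ^ 2 := by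
          refine Finset.sum_le_sum fun i _ => ?_
          rw [Real.norm_of_nonneg (hb i).le]
          have := hb i
          have := hbK i
          gcongr
      _ = _ := by simp; field_simp; ring
  have hc0 : 0 < ((∑ i, (‖b i‖₊ / 2) ^ 2 : NNReal) : ℝ) := by
    push_cast
    refine Finset.sum_pos (fun i _ => ?_) ⟨⟨0, hn⟩, Finset.mem_univ _⟩
    have := norm_pos_iff.2 (hb i).ne'
    positivity
  have hexp : Real.exp (-δ ^ 2 / (2 * (∑ i, (‖b i‖₊ / 2) ^ 2 : NNReal))) ≤
      Real.exp (-(2 * n * δ ^ 2 / K ^ 2)) := by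
    rw [Real.exp_le_exp, neg_div, neg_le_neg_iff]
    calc 2 * n * δ ^ 2 / K ^ 2 = δ ^ 2 / (2 * (K ^ 2 / (4 * n))) := by field_simp; ring
      _ ≤ _ := by gcongr
  have h1 := (ProbabilityTheory.HasSubgaussianMGF.measure_sum_ge_le_of_iIndepFun (s := .univ)
    (ProbabilityTheory.iIndepFun_pi (μ := fun i => uniformType (p i) (b i))
      (X := fun i x => x - (1 - p i) * b i / 2) fun i => by fun_prop)
      (fun i _ => hsub i) hδ).trans hexp
  have h2 := (ProbabilityTheory.HasSubgaussianMGF.measure_sum_ge_le_of_iIndepFun (s := .univ)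
    (ProbabilityTheory.iIndepFun_pi (μ := fun i => uniformType (p i) (b i))
      (X := fun i x => -(x - (1 - p i) * b i / 2)) fun i => by fun_prop)
      (fun i _ => (hsub i).neg) hδ).trans hexp
  rw [two_mul]
  refine le_trans ?_ (add_le_add h1 h2)
  refine le_trans (measureReal_mono ?_) (measureReal_union_le _ _)
  intro a ha
  simp only [Set.mem_ofPred_eq, Set.mem_union, Finset.sum_neg_distrib, Finset.sum_sub_distrib,
    hX] at ha ⊢
  exact le_abs.1 ha

/-! ### Won value and the effect of rescaling. -/

/-- The value that a player with battlefield values `w` wins with the allocation `x` against the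
allocation `y`, a tie being worth the share `α`. -/
noncomputable def wonValue {n : ℕ} (w : Fin n → ℝ) (α : ℝ) (x y : Fin n → ℝ) : ℝ :=
  ∑ i, w i * blottoA α (x i) (y i)

theorem blottoA_nonneg {α : ℝ} (hα : 0 ≤ α) (x y : ℝ) : 0 ≤ blottoA α x y := by
  unfold blottoA; split_ifs <;> simp [hα]

theorem blottoA_le_one {α : ℝ} (hα : α ≤ 1) (x y : ℝ) : blottoA α x y ≤ 1 := by
  unfold blottoA; split_ifs <;> simp [hα]

theorem wonValue_nonneg {n : ℕ} {w : Fin n → ℝ} {α : ℝ} (hw : ∀ i, 0 ≤ w i) (hα : 0 ≤ α)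
    (x y : Fin n → ℝ) : 0 ≤ wonValue w α x y :=
  Finset.sum_nonneg fun i _ => mul_nonneg (hw i) (blottoA_nonneg hα _ _)

theorem wonValue_le {n : ℕ} {w : Fin n → ℝ} {α : ℝ} (hw : ∀ i, 0 ≤ w i) (hα : α ≤ 1)
    (x y : Fin n → ℝ) : wonValue w α x y ≤ ∑ i, w i :=
  Finset.sum_le_sum fun i _ => mul_le_of_le_one_right (hw i) (blottoA_le_one hα _ _)

theorem measurable_wonValue {n : ℕ} (w : Fin n → ℝ) (α : ℝ) :
    Measurable fun z : (Fin n → ℝ) × (Fin n → ℝ) => wonValue w α z.1 z.2 := by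
  have h1 : ∀ i, Measurable fun z : (Fin n → ℝ) × (Fin n → ℝ) => z.1 i := fun i =>
    (measurable_pi_apply i).comp measurable_fst
  have h2 : ∀ i, Measurable fun z : (Fin n → ℝ) × (Fin n → ℝ) => z.2 i := fun i =>
    (measurable_pi_apply i).comp measurable_snd
  refine Finset.measurable_sum _ fun i _ => Measurable.const_mul ?_ _
  exact Measurable.ite (measurableSet_lt (h2 i) (h1 i)) measurable_const
    (Measurable.ite (measurableSet_eq_fun (h1 i) (h2 i)) measurable_const measurable_const)

theorem integrable_wonValue {Ω : Type*} [MeasurableSpace Ω] {P : Measure Ω} [IsProbabilityMeasure P]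
    {n : ℕ} {w : Fin n → ℝ} {α : ℝ} (hw : ∀ i, 0 ≤ w i) (hα0 : 0 ≤ α) (hα1 : α ≤ 1)
    {f g : Ω → Fin n → ℝ} (hf : Measurable f) (hg : Measurable g) :
    Integrable (fun ω => wonValue w α (f ω) (g ω)) P :=
  Integrable.of_mem_Icc 0 (∑ i, w i)
    ((measurable_wonValue w α).comp (hf.prodMk hg)).aemeasurable
    (Filter.Eventually.of_forall fun _ =>
      ⟨wonValue_nonneg hw hα0 _ _, wonValue_le hw hα1 _ _⟩)

theorem measurableSet_abs_sum_sub_ge {n : ℕ} (δ X : ℝ) :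
    MeasurableSet {a : Fin n → ℝ | δ ≤ |∑ i, a i - X|} :=
  measurableSet_le measurable_const (by fun_prop)

/-- The total of `b` is below `(1 + η) * Y`, so rescaling shrinks each draw by a factor less than `1
+ η`: a draw above `(1 + η) * x i` still beats `x i`. -/
theorem wonValue_rescale_right_le {n : ℕ} {w x b : Fin n → ℝ} {α Y η : ℝ} (hw : ∀ i, 0 ≤ w i)
    (hα : α ≤ 1) (hx : ∀ i, 0 ≤ x i) (hY : 0 < Y) (hη : η < 1)
    (hb : |∑ i, b i - Y| < η * Y) :
    wonValue w α x (rescale Y b) ≤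
      ∑ i, w i * (Set.Iic ((1 + η) * x i)).indicator 1 (b i) := by
  rw [abs_lt] at hb
  have hS : 0 < ∑ i, b i := by nlinarith
  refine Finset.sum_le_sum fun i _ => mul_le_mul_of_nonneg_left ?_ (hw i)
  by_cases hi : b i ≤ (1 + η) * x i
  · simpa [Set.indicator, hi] using blottoA_le_one hα _ _
  · have : x i < rescale Y b i := by
      rw [rescale, if_neg hS.ne', div_mul_eq_mul_div, lt_div_iff₀ hS]
      nlinarith [hx i]
    simp [Set.indicator, hi, blottoA, this.not_gt, this.ne]

/-- In the worst case the winner's total is `(1 + η) * X` and the loser's is `(1 - η) * Y`; a margin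
of the quotient of these factors in the raw draws survives both rescalings. -/
theorem le_wonValue_rescale {n : ℕ} {w a b : Fin n → ℝ} {α X Y η : ℝ} (hw : ∀ i, 0 ≤ w i)
    (hα : 0 ≤ α) (hb0 : ∀ i, 0 ≤ b i) (hX : 0 < X) (hY : 0 < Y) (hη0 : 0 < η) (hη : η < 1)
    (ha : |∑ i, a i - X| < η * X) (hb : |∑ i, b i - Y| < η * Y) :
    ∑ i, w i * {z : ℝ × ℝ | z.2 < (1 - η) / (1 + η) * z.1}.indicator 1 (a i, b i) ≤
      wonValue w α (rescale X a) (rescale Y b) := by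
  rw [abs_lt] at ha hb
  have hA : 0 < ∑ i, a i := by nlinarith
  have hB : 0 < ∑ i, b i := by nlinarith
  refine Finset.sum_le_sum fun i _ => mul_le_mul_of_nonneg_left ?_ (hw i)
  by_cases hi : b i < (1 - η) / (1 + η) * a i
  · have hai : 0 < a i := by
      have := (hb0 i).trans_lt hi
      exact pos_of_mul_pos_right this (div_nonneg (by linarith) (by linarith))
    have : rescale Y b i < rescale X a i := by
      rw [rescale, rescale, if_neg hA.ne', if_neg hB.ne', div_mul_eq_mul_div, div_mul_eq_mul_div,
        div_lt_div_iff₀ hB hA]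
      rw [div_mul_eq_mul_div, lt_div_iff₀ (by linarith)] at hi
      calc b i * Y * ∑ i, a i ≤ b i * Y * ((1 + η) * X) :=
            mul_le_mul_of_nonneg_left (by linarith) (mul_nonneg (hb0 i) hY.le)
        _ = b i * (1 + η) * (X * Y) := by ring
        _ < (1 - η) * a i * (X * Y) := mul_lt_mul_of_pos_right hi (mul_pos hX hY)
        _ = a i * X * ((1 - η) * Y) := by ring
        _ ≤ _ := mul_le_mul_of_nonneg_left (by linarith) (mul_nonneg hai.le hX.le)
    simp [Set.indicator, hi, blottoA, this]
  · simpa [Set.indicator, hi] using blottoA_nonneg hα _ _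

theorem integral_indicator_comp {Ω S : Type*} [MeasurableSpace Ω] [MeasurableSpace S]
    {P : Measure Ω} {Q : Measure S} {f : Ω → S} (hf : MeasurePreserving f P Q) {s : Set S}
    (hs : MeasurableSet s) : ∫ ω, s.indicator (1 : S → ℝ) (f ω) ∂P = Q.real s := by
  rw [← integral_indicator_one hs, ← hf.map_eq, integral_map hf.measurable.aemeasurable]
  exact (measurable_one.indicator hs).aestronglyMeasurable

theorem integrable_indicator_comp {Ω S : Type*} [MeasurableSpace Ω] [MeasurableSpace S]
    {P : Measure Ω} [IsFiniteMeasure P] {f : Ω → S} (hf : Measurable f) {s : Set S}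
    (hs : MeasurableSet s) : Integrable (fun ω => s.indicator (1 : S → ℝ) (f ω)) P :=
  (integrable_const (1 : ℝ)).indicator (hf hs)

theorem integral_sum_mul_indicator_comp {Ω S ι : Type*} [MeasurableSpace Ω] [MeasurableSpace S]
    [Fintype ι] {P : Measure Ω} [IsFiniteMeasure P] {Q : ι → Measure S} {f : ι → Ω → S}
    (hf : ∀ i, MeasurePreserving (f i) P (Q i)) {s : ι → Set S} (hs : ∀ i, MeasurableSet (s i))
    (w : ι → ℝ) :
    ∫ ω, ∑ i, w i * (s i).indicator (1 : S → ℝ) (f i ω) ∂P = ∑ i, w i * (Q i).real (s i) := by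
  rw [integral_finsetSum _ fun i _ =>
    (integrable_indicator_comp (hf i).measurable (hs i)).const_mul _]
  exact Finset.sum_congr rfl fun i _ => by
    rw [integral_const_mul, integral_indicator_comp (hf i) (hs i)]

/-! ### Pure deviations compared with independently uniform play. -/

section

variable {n : ℕ} {w p q b : Fin n → ℝ} {α X Y l η τ : ℝ}

/-- Since `l` is the same on all battlefields, the sum of the affine bounds sees `x` only through
its total. The failure event costs at most the whole value, with probability `τ`. -/
theorem integral_wonValue_rescale_le (hw : ∀ i, 0 ≤ w i) (hα0 : 0 ≤ α) (hα1 : α ≤ 1)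
    (hq0 : ∀ i, 0 ≤ q i) (hq1 : ∀ i, q i ≤ 1) (hb : ∀ i, 0 < b i) (hl0 : 0 ≤ l)
    (hl : ∀ i, w i * ((1 - q i) / b i) = l) (hY : 0 < Y) (hη0 : 0 < η) (hη1 : η < 1)
    (hτ : (Measure.pi fun i => uniformType (q i) (b i)).real
      {a | η * Y ≤ |∑ i, a i - Y|} ≤ τ)
    {x : Fin n → ℝ} (hx : x ∈ pureStrategies n X) :
    ∫ y, wonValue w α x (rescale Y y) ∂(Measure.pi fun i => uniformType (q i) (b i)) ≤
      (∑ i, w i * q i) + l * X * (1 + η) + (∑ i, w i) * τ := by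
  have hU := fun i => uniformType_isProbabilityMeasure (hq0 i) (hq1 i) (hb i)
  set P := Measure.pi fun i => uniformType (q i) (b i) with hP
  have hW : 0 ≤ ∑ i, w i := Finset.sum_nonneg fun i _ => hw i
  set B := {a : Fin n → ℝ | η * Y ≤ |∑ i, a i - Y|}
  have hBm : MeasurableSet B := measurableSet_abs_sum_sub_ge _ _
  have hpt : ∀ y, wonValue w α x (rescale Y y) ≤
      ∑ i, w i * (Set.Iic ((1 + η) * x i)).indicator 1 (y i) + (∑ i, w i) * B.indicator 1 y := by
    intro y
    by_cases hy : y ∈ B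
    · have : 0 ≤ ∑ i, w i * (Set.Iic ((1 + η) * x i)).indicator (1 : ℝ → ℝ) (y i) :=
        Finset.sum_nonneg fun i _ =>
          mul_nonneg (hw i) (Set.indicator_nonneg (fun _ _ => zero_le_one) _)
      have := wonValue_le hw hα1 x (rescale Y y)
      simp only [Set.indicator_of_mem hy, Pi.one_apply]
      linarith
    · have := wonValue_rescale_right_le hw hα1 hx.1 hY hη1 (not_le.1 hy)
      simpa [Set.indicator_of_notMem hy] using this
  have hi1 : Integrable (fun y : Fin n → ℝ =>
      ∑ i, w i * (Set.Iic ((1 + η) * x i)).indicator (1 : ℝ → ℝ) (y i)) P :=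
    integrable_finsetSum _ fun i _ =>
      (integrable_indicator_comp (measurable_pi_apply i) measurableSet_Iic).const_mul _
  have hi2 : Integrable (fun y => (∑ i, w i) * B.indicator (1 : (Fin n → ℝ) → ℝ) y) P :=
    ((integrable_const (1 : ℝ)).indicator hBm).const_mul _
  calc _ ≤ ∫ y, (∑ i, w i * (Set.Iic ((1 + η) * x i)).indicator 1 (y i) +
          (∑ i, w i) * B.indicator 1 y) ∂P :=
        integral_mono (integrable_wonValue hw hα0 hα1 measurable_const (measurable_rescale Y))
          (hi1.add hi2) hpt
    _ = (∑ i, w i * (uniformType (q i) (b i)).real (Set.Iic ((1 + η) * x i))) +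
          (∑ i, w i) * P.real B := by
        rw [integral_add hi1 hi2, integral_const_mul, integral_indicator_one hBm,
          integral_sum_mul_indicator_comp
            (fun i => measurePreserving_eval (fun i => uniformType (q i) (b i)) i)
            fun i => measurableSet_Iic]
    _ ≤ (∑ i, (w i * q i + l * (1 + η) * x i)) + (∑ i, w i) * τ := by
        refine add_le_add (Finset.sum_le_sum fun i _ => ?_) (mul_le_mul_of_nonneg_left hτ hW)
        calc _ ≤ w i * (q i + (1 - q i) / b i * ((1 + η) * x i)) :=
              mul_le_mul_of_nonneg_left (uniformType_real_Iic_le (hq0 i) (hq1 i) (hb i)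
                (mul_nonneg (by linarith) (hx.1 i))) (hw i)
          _ = _ := by rw [← hl i]; ring
    _ ≤ _ := by
        rw [Finset.sum_add_distrib, ← Finset.mul_sum]
        have : l * (1 + η) * ∑ i, x i ≤ l * (1 + η) * X :=
          mul_le_mul_of_nonneg_left hx.2 (mul_nonneg hl0 (by linarith))
        linarith

/-- The matching lower bound: the mean total of the draws with atoms `p` is exactly `X` by `hsum`,
so the linear terms add up to `l * X`, up to the rescaling margin and two failure events. -/
theorem le_integral_wonValue_rescale (hw : ∀ i, 0 ≤ w i) (hα0 : 0 ≤ α) (hα1 : α ≤ 1)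
    (hp0 : ∀ i, 0 ≤ p i) (hp1 : ∀ i, p i ≤ 1) (hq0 : ∀ i, 0 ≤ q i) (hq1 : ∀ i, q i ≤ 1)
    (hpq : ∀ i, p i = 0 ∨ q i = 0) (hb : ∀ i, 0 < b i)
    (hl : ∀ i, w i * ((1 - q i) / b i) = l) (hX : 0 < X) (hY : 0 < Y)
    (hsum : ∑ i, (1 - p i) * b i / 2 = X) (hη0 : 0 < η) (hη1 : η < 1)
    (hτp : (Measure.pi fun i => uniformType (p i) (b i)).real
      {a | η * X ≤ |∑ i, a i - X|} ≤ τ)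
    (hτq : (Measure.pi fun i => uniformType (q i) (b i)).real
      {a | η * Y ≤ |∑ i, a i - Y|} ≤ τ) :
    (∑ i, w i * q i) + l * X * ((1 - η) / (1 + η)) - 2 * (∑ i, w i) * τ ≤
      ∫ z, wonValue w α (rescale X z.1) (rescale Y z.2)
        ∂((Measure.pi fun i => uniformType (p i) (b i)).prod
          (Measure.pi fun i => uniformType (q i) (b i))) := by
  have hUp := fun i => uniformType_isProbabilityMeasure (hp0 i) (hp1 i) (hb i)
  have hUq := fun i => uniformType_isProbabilityMeasure (hq0 i) (hq1 i) (hb i)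
  set P := Measure.pi fun i => uniformType (p i) (b i) with hP
  set Q := Measure.pi fun i => uniformType (q i) (b i) with hQ
  have hW : 0 ≤ ∑ i, w i := Finset.sum_nonneg fun i _ => hw i
  set A := {a : Fin n → ℝ | η * X ≤ |∑ i, a i - X|}
  set B := {a : Fin n → ℝ | η * Y ≤ |∑ i, a i - Y|}
  have hAm : MeasurableSet A := measurableSet_abs_sum_sub_ge _ _
  have hBm : MeasurableSet B := measurableSet_abs_sum_sub_ge _ _
  set c := (1 - η) / (1 + η)
  have hc0 : 0 < c := div_pos (by linarith) (by linarith)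
  have hc1 : c ≤ 1 := (div_le_one (by linarith)).2 (by linarith)
  have hDm : MeasurableSet {z : ℝ × ℝ | z.2 < c * z.1} :=
    measurableSet_lt measurable_snd (measurable_fst.const_mul c)
  set D := {z : ℝ × ℝ | z.2 < c * z.1}
  have hev : ∀ i, MeasurePreserving (fun z : (Fin n → ℝ) × (Fin n → ℝ) => (z.1 i, z.2 i))
      (P.prod Q) ((uniformType (p i) (b i)).prod (uniformType (q i) (b i))) := fun i =>
    (measurePreserving_eval (fun i => uniformType (p i) (b i)) i).prod
      (measurePreserving_eval (fun i => uniformType (q i) (b i)) i)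
  have hnn : ∀ᵐ z ∂(P.prod Q), ∀ i, 0 ≤ z.2 i := by
    rw [ae_all_iff]
    intro i
    refine measurePreserving_snd.quasiMeasurePreserving.ae
      (ae_pi_eval i (P := fun x => 0 ≤ x) ?_)
    filter_upwards [uniformType_ae_mem_Icc (p := q i) (hb i)] with x hx using hx.1
  -- On a failure event the subtracted total makes the left side nonpositive, so only the good event
  -- needs an argument.
  have hpt : ∀ᵐ z ∂(P.prod Q), ∑ i, w i * D.indicator 1 (z.1 i, z.2 i) -
      (∑ i, w i) * (A.indicator 1 z.1 + B.indicator 1 z.2) ≤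
        wonValue w α (rescale X z.1) (rescale Y z.2) := by
    filter_upwards [hnn] with z hz
    have h0 := wonValue_nonneg hw hα0 (rescale X z.1) (rescale Y z.2)
    have h1 : ∑ i, w i * D.indicator (1 : ℝ × ℝ → ℝ) (z.1 i, z.2 i) ≤ ∑ i, w i :=
      Finset.sum_le_sum fun i _ => mul_le_of_le_one_right (hw i)
        (Set.indicator_le_self' (fun _ _ => zero_le_one) _)
    have hA0 : 0 ≤ A.indicator (1 : (Fin n → ℝ) → ℝ) z.1 :=
      Set.indicator_nonneg (fun _ _ => zero_le_one) _
    have hB0 : 0 ≤ B.indicator (1 : (Fin n → ℝ) → ℝ) z.2 :=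
      Set.indicator_nonneg (fun _ _ => zero_le_one) _
    by_cases hA : z.1 ∈ A
    · simp only [Set.indicator_of_mem hA, Pi.one_apply]
      nlinarith
    by_cases hB : z.2 ∈ B
    · simp only [Set.indicator_of_mem hB, Pi.one_apply]
      nlinarith
    simpa [Set.indicator_of_notMem hA, Set.indicator_of_notMem hB] using
      le_wonValue_rescale (α := α) hw hα0 hz hX hY hη0 hη1 (not_le.1 hA) (not_le.1 hB)
  have hi1 : Integrable (fun z : (Fin n → ℝ) × (Fin n → ℝ) =>
      ∑ i, w i * D.indicator (1 : ℝ × ℝ → ℝ) (z.1 i, z.2 i)) (P.prod Q) :=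
    integrable_finsetSum _ fun i _ =>
      (integrable_indicator_comp (hev i).measurable hDm).const_mul _
  have hiA : Integrable (fun z : (Fin n → ℝ) × (Fin n → ℝ) =>
      A.indicator (1 : (Fin n → ℝ) → ℝ) z.1) (P.prod Q) :=
    integrable_indicator_comp measurable_fst hAm
  have hiB : Integrable (fun z : (Fin n → ℝ) × (Fin n → ℝ) =>
      B.indicator (1 : (Fin n → ℝ) → ℝ) z.2) (P.prod Q) :=
    integrable_indicator_comp measurable_snd hBm
  have hiAB : Integrable (fun z : (Fin n → ℝ) × (Fin n → ℝ) => (∑ i, w i) *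
      (A.indicator (1 : (Fin n → ℝ) → ℝ) z.1 + B.indicator (1 : (Fin n → ℝ) → ℝ) z.2))
      (P.prod Q) := (hiA.add hiB).const_mul _
  calc _ ≤ (∑ i, w i * ((uniformType (p i) (b i)).prod (uniformType (q i) (b i))).real D) -
          (∑ i, w i) * (P.real A + Q.real B) := by
        have h1 : (∑ i, w i) * (P.real A + Q.real B) ≤ (∑ i, w i) * (τ + τ) :=
          mul_le_mul_of_nonneg_left (add_le_add hτp hτq) hW
        have h2 : ∑ i, (w i * q i + l * c * ((1 - p i) * b i / 2)) ≤
            ∑ i, w i * ((uniformType (p i) (b i)).prod (uniformType (q i) (b i))).real D := by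
          refine Finset.sum_le_sum fun i _ => ?_
          refine le_trans (le_of_eq ?_) (mul_le_mul_of_nonneg_left (le_prod_uniformType_real_lt
            (hp0 i) (hp1 i) (hq0 i) (hq1 i) (hpq i) (hb i) hc0 hc1) (hw i))
          rw [← hl i]; ring
        rw [Finset.sum_add_distrib, ← Finset.mul_sum, hsum] at h2
        linarith
    _ = ∫ z, (∑ i, w i * D.indicator 1 (z.1 i, z.2 i) -
          (∑ i, w i) * (A.indicator 1 z.1 + B.indicator 1 z.2)) ∂(P.prod Q) := by
        rw [integral_sub hi1 hiAB, integral_const_mul,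
          integral_add hiA hiB, integral_indicator_comp measurePreserving_fst hAm,
          integral_indicator_comp measurePreserving_snd hBm,
          integral_sum_mul_indicator_comp hev fun _ => hDm]
    _ ≤ _ := integral_mono_ae (hi1.sub hiAB)
        (integrable_wonValue hw hα0 hα1 ((measurable_rescale X).comp measurable_fst)
          ((measurable_rescale Y).comp measurable_snd)) hpt

/-- Against independently uniform play, no pure allocation wins much more than independently
uniform play does. -/
theorem integral_wonValue_rescale_le_add (hw : ∀ i, 0 ≤ w i) (hα0 : 0 ≤ α) (hα1 : α ≤ 1)
    (hp0 : ∀ i, 0 ≤ p i) (hp1 : ∀ i, p i ≤ 1) (hq0 : ∀ i, 0 ≤ q i) (hq1 : ∀ i, q i ≤ 1)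
    (hpq : ∀ i, p i = 0 ∨ q i = 0) (hb : ∀ i, 0 < b i) (hl0 : 0 ≤ l)
    (hl : ∀ i, w i * ((1 - q i) / b i) = l) (hX : 0 < X) (hY : 0 < Y)
    (hsum : ∑ i, (1 - p i) * b i / 2 = X) (hη0 : 0 < η) (hη1 : η < 1)
    (hτp : (Measure.pi fun i => uniformType (p i) (b i)).real
      {a | η * X ≤ |∑ i, a i - X|} ≤ τ)
    (hτq : (Measure.pi fun i => uniformType (q i) (b i)).real
      {a | η * Y ≤ |∑ i, a i - Y|} ≤ τ)
    {x : Fin n → ℝ} (hx : x ∈ pureStrategies n X) :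
    ∫ y, wonValue w α x (rescale Y y) ∂(Measure.pi fun i => uniformType (q i) (b i)) ≤
      ∫ z, wonValue w α (rescale X z.1) (rescale Y z.2)
        ∂((Measure.pi fun i => uniformType (p i) (b i)).prod
          (Measure.pi fun i => uniformType (q i) (b i))) +
      (2 * η + 3 * τ) * ∑ i, w i := by
  have h1 := integral_wonValue_rescale_le hw hα0 hα1 hq0 hq1 hb hl0 hl hY hη0 hη1 hτq hx
  have h2 := le_integral_wonValue_rescale hw hα0 hα1 hp0 hp1 hq0 hq1 hpq hb hl hX hY hsum hη0 hη1
    hτp hτq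
  -- This turns the loss in the linear term, at most `3 * η * (l * X)`, into a multiple of the total
  -- value: `3 / 2 * η`, relaxed to `2 * η`. The failure events contribute `τ` and `2 * τ`.
  have h3 : l * X ≤ (∑ i, w i) / 2 := by
    rw [← hsum, Finset.mul_sum, Finset.sum_div]
    refine Finset.sum_le_sum fun i _ => ?_
    rw [← hl i]
    have := (hb i).ne'
    calc w i * ((1 - q i) / b i) * ((1 - p i) * b i / 2) =
          w i * ((1 - q i) * (1 - p i)) / 2 := by field_simp
      _ ≤ w i * 1 / 2 := by
          gcongr
          · exact hw i
          · exact mul_le_one₀ (by linarith [hq0 i]) (by linarith [hp1 i]) (by linarith [hp0 i])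
      _ = _ := by rw [mul_one]
  have h4 : 1 - 2 * η ≤ (1 - η) / (1 + η) := by
    rw [le_div_iff₀ (by linarith)]; nlinarith
  have h5 := mul_le_mul_of_nonneg_left h4 (mul_nonneg hl0 hX.le)
  have h6 := mul_le_mul_of_nonneg_right h3 hη0.le
  have h7 : 0 ≤ (∑ i, w i) * η := mul_nonneg (Finset.sum_nonneg fun i _ => hw i) hη0.le
  linarith

end

theorem integral_wonValue_dirac_prod_map {Ω : Type*} [MeasurableSpace Ω] {P : Measure Ω}
    [SFinite P] {n : ℕ} (w : Fin n → ℝ) (α : ℝ) (x : Fin n → ℝ) {f : Ω → Fin n → ℝ}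
    (hf : Measurable f) :
    ∫ z, wonValue w α z.1 z.2 ∂((Measure.dirac x).prod (P.map f)) =
      ∫ y, wonValue w α x (f y) ∂P := by
  rw [Measure.dirac_prod, Measure.map_map measurable_prodMk_left hf,
    integral_map (measurable_prodMk_left.comp hf).aemeasurable
      (measurable_wonValue w α).aestronglyMeasurable]
  rfl

theorem integral_wonValue_map_prod_map {Ω Ω' : Type*} [MeasurableSpace Ω] [MeasurableSpace Ω']
    {P : Measure Ω} {Q : Measure Ω'} [SFinite P] [SFinite Q] {n : ℕ} (w : Fin n → ℝ) (α : ℝ)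
    {f : Ω → Fin n → ℝ} {g : Ω' → Fin n → ℝ} (hf : Measurable f) (hg : Measurable g) :
    ∫ z, wonValue w α z.1 z.2 ∂((P.map f).prod (Q.map g)) =
      ∫ z, wonValue w α (f z.1) (g z.2) ∂(P.prod Q) := by
  rw [Measure.map_prod_map _ _ hf hg, integral_map (hf.prodMap hg).aemeasurable
      (measurable_wonValue w α).aestronglyMeasurable]
  rfl

/-! ### Parameters of the uniform-type distributions attached to a solution. -/

namespace GCBGame

variable {n : ℕ} {XA XB : ℝ} (G : GCBGame n XA XB)

theorem expPayoffA_eq (s t : Measure (Fin n → ℝ)) :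
    G.expPayoffA s t = ∫ z, wonValue G.wA G.α z.1 z.2 ∂(s.prod t) := rfl

/-- Exchanging the players turns `α` into `1 - α`, so estimates for `wonValue` serve both. -/
theorem expPayoffB_eq (s t : Measure (Fin n → ℝ)) [SFinite s] [SFinite t] :
    G.expPayoffB s t = ∫ z, wonValue G.wB (1 - G.α) z.1 z.2 ∂(t.prod s) := by
  rw [← integral_prod_swap]
  rfl

/-- The right endpoint of the support of both uniform-type distributions on battlefield `i`. -/
noncomputable def endpoint (γ : ℝ) (i : Fin n) : ℝ :=
  if i ∈ G.Omega γ then G.vB i / G.lambdaB γ else G.vA i / G.lambdaA γ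

/-- The mass that A's uniform-type distribution on battlefield `i` has at `0`. -/
noncomputable def atomA (γ : ℝ) (i : Fin n) : ℝ :=
  if i ∈ G.Omega γ then 0 else
    (G.vB i / G.lambdaB γ - G.vA i / G.lambdaA γ) / (G.vB i / G.lambdaB γ)

/-- The mass that B's uniform-type distribution on battlefield `i` has at `0`. -/
noncomputable def atomB (γ : ℝ) (i : Fin n) : ℝ :=
  if i ∈ G.Omega γ then
    (G.vA i / G.lambdaA γ - G.vB i / G.lambdaB γ) / (G.vA i / G.lambdaA γ) else 0

theorem distA_eq (γ : ℝ) : G.distA γ = fun i => uniformType (G.atomA γ i) (G.endpoint γ i) := by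
  ext1 i; unfold distA atomA endpoint; split_ifs <;> rfl

theorem distB_eq (γ : ℝ) : G.distB γ = fun i => uniformType (G.atomB γ i) (G.endpoint γ i) := by
  ext1 i; unfold distB atomB endpoint; split_ifs <;> rfl

theorem n_pos (G : GCBGame n XA XB) : 0 < n := by have := G.three_le; omega

theorem univ_nonempty (G : GCBGame n XA XB) : (Finset.univ : Finset (Fin n)).Nonempty :=
  ⟨⟨0, G.n_pos⟩, Finset.mem_univ _⟩

theorem totalA_pos : 0 < G.totalA := Finset.sum_pos (fun i _ => G.wA_pos i) G.univ_nonempty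

theorem totalB_pos : 0 < G.totalB := Finset.sum_pos (fun i _ => G.wB_pos i) G.univ_nonempty

theorem vA_pos (i : Fin n) : 0 < G.vA i := div_pos (G.wA_pos i) G.totalA_pos

theorem vB_pos (i : Fin n) : 0 < G.vB i := div_pos (G.wB_pos i) G.totalB_pos

theorem sum_vA : ∑ i, G.vA i = 1 := by
  simp only [vA]; rw [← Finset.sum_div]; exact div_self G.totalA_pos.ne'

theorem sum_vB : ∑ i, G.vB i = 1 := by
  simp only [vB]; rw [← Finset.sum_div]; exact div_self G.totalB_pos.ne'

theorem XB_pos (G : GCBGame n XA XB) : 0 < XB := G.XA_pos.trans_le G.XA_le_XB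

theorem mem_Omega {γ : ℝ} {i : Fin n} : i ∈ G.Omega γ ↔ γ * G.vB i < G.vA i := by
  rw [Omega, Finset.mem_filter, gt_iff_lt, lt_div_iff₀ (G.vB_pos i)]; simp

theorem sum_Omega_add (γ : ℝ) (f g : Fin n → ℝ) :
    ∑ i ∈ G.Omega γ, f i + ∑ i ∈ (G.Omega γ)ᶜ, g i =
      ∑ i, if i ∈ G.Omega γ then f i else g i := by
  rw [← Finset.sum_add_sum_compl (G.Omega γ)]
  refine congrArg₂ _ (Finset.sum_congr rfl fun i hi => ?_) (Finset.sum_congr rfl fun i hi => ?_)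
  · rw [if_pos hi]
  · rw [if_neg (Finset.mem_compl.1 hi)]

theorem two_mul_XB_mul_lambdaA (γ : ℝ) : 2 * XB * G.lambdaA γ =
    ∑ i, if i ∈ G.Omega γ then γ ^ 2 * (G.vB i ^ 2 / G.vA i) else G.vA i := by
  have := G.XB_pos
  rw [← sum_Omega_add, ← Finset.mul_sum, lambdaA]
  field_simp

theorem two_mul_XA_mul_lambdaB {γ : ℝ} (hγ : 0 < γ) : 2 * XA * G.lambdaB γ =
    ∑ i, if i ∈ G.Omega γ then G.vB i else 1 / γ ^ 2 * (G.vA i ^ 2 / G.vB i) := by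
  have := G.XA_pos
  rw [← sum_Omega_add, ← Finset.mul_sum, lambdaB]
  field_simp

theorem lambdaA_pos {γ : ℝ} (hγ : 0 < γ) : 0 < G.lambdaA γ := by
  have h : 0 < 2 * XB * G.lambdaA γ := by
    rw [two_mul_XB_mul_lambdaA]
    refine Finset.sum_pos (fun i _ => ?_) G.univ_nonempty
    have := G.vA_pos i
    have := G.vB_pos i
    split_ifs <;> positivity
  have := G.XB_pos
  exact pos_of_mul_pos_right h (by positivity)

theorem lambdaB_pos {γ : ℝ} (hγ : 0 < γ) : 0 < G.lambdaB γ := by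
  have h : 0 < 2 * XA * G.lambdaB γ := by
    rw [G.two_mul_XA_mul_lambdaB hγ]
    refine Finset.sum_pos (fun i _ => ?_) G.univ_nonempty
    have := G.vA_pos i
    have := G.vB_pos i
    split_ifs <;> positivity
  have := G.XA_pos
  exact pos_of_mul_pos_right h (by positivity)

/-- This is the defining equation of `solutions`: its numerator is `2 * XB * λ_A` and its
denominator `2 * XA * λ_B`. Membership in `Omega γ` thereby becomes the comparison of `s i` with `t
i`, so `endpoint` is their minimum and the atoms are nonnegative. -/
theorem lambdaA_eq {γ : ℝ} (h : γ ∈ G.solutions) : G.lambdaA γ = γ * G.lambdaB γ := by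
  obtain ⟨hγ, h⟩ := h
  have hA := G.XA_pos
  have hB := G.XB_pos
  have h1 := G.two_mul_XB_mul_lambdaA γ
  have h2 := G.two_mul_XA_mul_lambdaB hγ
  rw [← sum_Omega_add, ← Finset.mul_sum] at h1 h2
  rw [← h1, ← h2] at h
  have := G.lambdaB_pos hγ
  field_simp at h
  linarith

variable {G} {γ : ℝ}

theorem endpoint_pos (h : γ ∈ G.solutions) (i : Fin n) : 0 < G.endpoint γ i := by
  unfold endpoint
  split_ifs
  · exact div_pos (G.vB_pos i) (G.lambdaB_pos h.1)
  · exact div_pos (G.vA_pos i) (G.lambdaA_pos h.1)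

theorem lt_div_lambdaA (h : γ ∈ G.solutions) {i : Fin n} (hi : i ∈ G.Omega γ) :
    G.vB i / G.lambdaB γ < G.vA i / G.lambdaA γ := by
  have hB := G.lambdaB_pos h.1
  rw [G.lambdaA_eq h, div_lt_div_iff₀ hB (mul_pos h.1 hB)]
  nlinarith [G.mem_Omega.1 hi]

theorem div_lambdaA_le (h : γ ∈ G.solutions) {i : Fin n} (hi : i ∉ G.Omega γ) :
    G.vA i / G.lambdaA γ ≤ G.vB i / G.lambdaB γ := by
  have hB := G.lambdaB_pos h.1
  rw [G.lambdaA_eq h, div_le_div_iff₀ (mul_pos h.1 hB) hB]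
  nlinarith [not_lt.1 (mt G.mem_Omega.2 hi)]

theorem endpoint_le_div_lambdaA (h : γ ∈ G.solutions) (i : Fin n) :
    G.endpoint γ i ≤ G.vA i / G.lambdaA γ := by
  unfold endpoint
  split_ifs with hi
  · exact (lt_div_lambdaA h hi).le
  · exact le_rfl

theorem endpoint_le_div_lambdaB (h : γ ∈ G.solutions) (i : Fin n) :
    G.endpoint γ i ≤ G.vB i / G.lambdaB γ := by
  unfold endpoint
  split_ifs with hi
  · exact le_rfl
  · exact div_lambdaA_le h hi

theorem one_sub_atomA (h : γ ∈ G.solutions) (i : Fin n) :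
    1 - G.atomA γ i = G.endpoint γ i / (G.vB i / G.lambdaB γ) := by
  have ht := div_pos (G.vB_pos i) (G.lambdaB_pos h.1)
  unfold atomA endpoint
  split_ifs
  · rw [sub_zero, div_self ht.ne']
  · rw [sub_div, div_self ht.ne', sub_sub_cancel]

theorem one_sub_atomB (h : γ ∈ G.solutions) (i : Fin n) :
    1 - G.atomB γ i = G.endpoint γ i / (G.vA i / G.lambdaA γ) := by
  have ht := div_pos (G.vA_pos i) (G.lambdaA_pos h.1)
  unfold atomB endpoint
  split_ifs
  · rw [sub_div, div_self ht.ne', sub_sub_cancel]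
  · rw [sub_zero, div_self ht.ne']

theorem atomA_mem_Icc (h : γ ∈ G.solutions) (i : Fin n) : G.atomA γ i ∈ Set.Icc 0 1 := by
  have ht := div_pos (G.vB_pos i) (G.lambdaB_pos h.1)
  have h0 := one_sub_atomA h i
  have h1 := div_pos (endpoint_pos h i) ht
  have h2 := (div_le_one ht).2 (endpoint_le_div_lambdaB h i)
  constructor <;> linarith

theorem atomB_mem_Icc (h : γ ∈ G.solutions) (i : Fin n) : G.atomB γ i ∈ Set.Icc 0 1 := by
  have ht := div_pos (G.vA_pos i) (G.lambdaA_pos h.1)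
  have h0 := one_sub_atomB h i
  have h1 := div_pos (endpoint_pos h i) ht
  have h2 := (div_le_one ht).2 (endpoint_le_div_lambdaA h i)
  constructor <;> linarith

theorem atomA_eq_zero_or (i : Fin n) : G.atomA γ i = 0 ∨ G.atomB γ i = 0 := by
  unfold atomA atomB
  split_ifs <;> simp

/-- The equalization behind the equilibrium: A's marginal value of resources against B's draws does
not depend on the battlefield. -/
theorem wA_mul_density (h : γ ∈ G.solutions) (i : Fin n) :
    G.wA i * ((1 - G.atomB γ i) / G.endpoint γ i) = G.totalA * G.lambdaA γ := by
  have := (endpoint_pos h i).ne'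
  have := (G.lambdaA_pos h.1).ne'
  have := G.totalA_pos.ne'
  have := (G.wA_pos i).ne'
  rw [one_sub_atomB h, vA]
  field_simp

theorem wB_mul_density (h : γ ∈ G.solutions) (i : Fin n) :
    G.wB i * ((1 - G.atomA γ i) / G.endpoint γ i) = G.totalB * G.lambdaB γ := by
  have := (endpoint_pos h i).ne'
  have := (G.lambdaB_pos h.1).ne'
  have := G.totalB_pos.ne'
  have := (G.wB_pos i).ne'
  rw [one_sub_atomA h, vB]
  field_simp

/-- The multiplier `λ_B` is normalized precisely so that A's draws exhaust A's budget on average. -/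
theorem sum_mean_distA (h : γ ∈ G.solutions) :
    ∑ i, (1 - G.atomA γ i) * G.endpoint γ i / 2 = XA := by
  have hl := G.lambdaB_pos h.1
  have hγ := h.1
  have h2 := G.two_mul_XA_mul_lambdaB h.1
  have : XA = ∑ i, (if i ∈ G.Omega γ then G.vB i else 1 / γ ^ 2 * (G.vA i ^ 2 / G.vB i)) /
      (2 * G.lambdaB γ) := by
    rw [← Finset.sum_div, ← h2]; field_simp
  refine Eq.trans (Finset.sum_congr rfl fun i _ => ?_) this.symm
  have := G.vB_pos i
  rw [one_sub_atomA h, endpoint, G.lambdaA_eq h]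
  split_ifs <;> field_simp

theorem sum_mean_distB (h : γ ∈ G.solutions) :
    ∑ i, (1 - G.atomB γ i) * G.endpoint γ i / 2 = XB := by
  have hl := G.lambdaA_pos h.1
  have hlB := G.lambdaB_pos h.1
  have hγ := h.1
  have h2 := G.two_mul_XB_mul_lambdaA γ
  have : XB = ∑ i, (if i ∈ G.Omega γ then γ ^ 2 * (G.vB i ^ 2 / G.vA i) else G.vA i) /
      (2 * G.lambdaA γ) := by
    rw [← Finset.sum_div, ← h2]; field_simp
  refine Eq.trans (Finset.sum_congr rfl fun i _ => ?_) this.symm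
  have := G.vA_pos i
  rw [one_sub_atomB h, endpoint, G.lambdaA_eq h]
  split_ifs <;> field_simp

end GCBGame

/-! ### Uniform bounds over all games with values in a fixed range. -/

namespace GCBGame

variable {n : ℕ} {XA XB wlo whi γ : ℝ} {G : GCBGame n XA XB}

theorem div_sum_mem_Icc {w : Fin n → ℝ} (hn : 0 < n) (hlo : 0 < wlo)
    (hw : ∀ i, wlo ≤ w i ∧ w i ≤ whi) (i : Fin n) :
    w i / ∑ j, w j ∈ Set.Icc (1 / (whi / wlo * n)) (whi / wlo / n) := by
  have hn' : (0 : ℝ) < n := by exact_mod_cast hn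
  have h1 : n * wlo ≤ ∑ j, w j := by
    simpa using Finset.sum_le_sum fun j (_ : j ∈ Finset.univ) => (hw j).1
  have h2 : ∑ j, w j ≤ n * whi := by
    simpa using Finset.sum_le_sum fun j (_ : j ∈ Finset.univ) => (hw j).2
  have hhi : 0 < whi := hlo.trans_le ((hw i).1.trans (hw i).2)
  have hS : 0 < ∑ j, w j := (mul_pos hn' hlo).trans_le h1
  have hwi : 0 < w i := hlo.trans_le (hw i).1
  constructor
  · calc 1 / (whi / wlo * n) = wlo / (n * whi) := by field_simp
      _ ≤ _ := div_le_div₀ hwi.le (hw i).1 hS h2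
  · calc _ ≤ whi / (n * wlo) := div_le_div₀ hhi.le (hw i).2 (mul_pos hn' hlo) h1
      _ = _ := by field_simp

theorem ValuesWithin.vA_mem_Icc (hG : G.ValuesWithin wlo whi) (hlo : 0 < wlo) (i : Fin n) :
    G.vA i ∈ Set.Icc (1 / (whi / wlo * n)) (whi / wlo / n) :=
  div_sum_mem_Icc G.n_pos hlo (fun i => (hG i).1) i

theorem ValuesWithin.vB_mem_Icc (hG : G.ValuesWithin wlo whi) (hlo : 0 < wlo) (i : Fin n) :
    G.vB i ∈ Set.Icc (1 / (whi / wlo * n)) (whi / wlo / n) :=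
  div_sum_mem_Icc G.n_pos hlo (fun i => (hG i).2) i

theorem le_sq_mul_of_mem_Icc {r m x y : ℝ} (hr : 0 < r) (hm : 0 < m)
    (hx : x ∈ Set.Icc (1 / (r * m)) (r / m)) (hy : y ∈ Set.Icc (1 / (r * m)) (r / m)) :
    x ≤ r ^ 2 * y :=
  calc x ≤ r / m := hx.2
    _ = r ^ 2 * (1 / (r * m)) := by field_simp
    _ ≤ _ := mul_le_mul_of_nonneg_left hy.1 (sq_nonneg r)

/-- All normalized values lie within a factor `r = whi / wlo` of `1 / n`, so any two differ by a
factor at most `r ^ 2`. It then suffices to bound one of the two multipliers below, since the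
endpoint is at most both `s i` and `t i`. -/
theorem endpoint_le (hG : G.ValuesWithin wlo whi) (hlo : 0 < wlo) (h : γ ∈ G.solutions)
    (i : Fin n) : G.endpoint γ i ≤ 2 * XB * (whi / wlo) ^ 5 / n := by
  have hwi : wlo ≤ whi := (hG i).1.1.trans (hG i).1.2
  have hr : 1 ≤ whi / wlo := (one_le_div hlo).2 hwi
  have hn : (0 : ℝ) < n := by exact_mod_cast G.n_pos
  set r := whi / wlo
  have hr0 : 0 < r := by linarith
  have hr4 : 1 ≤ r ^ 4 := one_le_pow₀ hr
  have hAB := fun j => le_sq_mul_of_mem_Icc hr0 hn (hG.vA_mem_Icc hlo j) (hG.vB_mem_Icc hlo j)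
  have hBA := fun j => le_sq_mul_of_mem_Icc hr0 hn (hG.vB_mem_Icc hlo j) (hG.vA_mem_Icc hlo j)
  have hvA := (hG.vA_mem_Icc hlo i).2
  have hvB := (hG.vB_mem_Icc hlo i).2
  have hXA := G.XA_pos
  have hXB := G.XB_pos
  have hγ := h.1
  -- No a priori bound on `γ` is needed: for `γ ≥ 1` the factor `γ ^ 2` only helps `λ_A`, and for `γ
  -- ≤ 1` the factor `1 / γ ^ 2` only helps `λ_B`.
  rcases le_total 1 γ with h1 | h1
  · have hl : 1 ≤ r ^ 4 * (2 * XB * G.lambdaA γ) := by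
      rw [two_mul_XB_mul_lambdaA, Finset.mul_sum]
      refine G.sum_vA.symm.trans_le (Finset.sum_le_sum fun j _ => ?_)
      have hA := G.vA_pos j
      have hB := G.vB_pos j
      split_ifs
      · have : G.vA j ^ 2 ≤ r ^ 4 * G.vB j ^ 2 := by
          calc _ ≤ (r ^ 2 * G.vB j) ^ 2 := pow_le_pow_left₀ hA.le (hAB j) 2
            _ = _ := by ring
        have h2 : r ^ 4 * G.vB j ^ 2 ≤ r ^ 4 * (γ ^ 2 * G.vB j ^ 2) := by
          gcongr
          exact le_mul_of_one_le_left (sq_nonneg _) (one_le_pow₀ h1)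
        calc G.vA j = G.vA j ^ 2 / G.vA j := by field_simp
          _ ≤ r ^ 4 * (γ ^ 2 * G.vB j ^ 2) / G.vA j := by gcongr; exact this.trans h2
          _ = _ := by ring
      · exact le_mul_of_one_le_left hA.le hr4
    have hlA := G.lambdaA_pos hγ
    refine (endpoint_le_div_lambdaA h i).trans ?_
    rw [div_le_iff₀ hlA]
    calc G.vA i ≤ r / n * 1 := by simpa using hvA
      _ ≤ r / n * (r ^ 4 * (2 * XB * G.lambdaA γ)) := by gcongr
      _ = _ := by ring
  · have hl : 1 ≤ r ^ 4 * (2 * XA * G.lambdaB γ) := by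
      rw [G.two_mul_XA_mul_lambdaB hγ, Finset.mul_sum]
      refine G.sum_vB.symm.trans_le (Finset.sum_le_sum fun j _ => ?_)
      have hA := G.vA_pos j
      have hB := G.vB_pos j
      split_ifs
      · exact le_mul_of_one_le_left hB.le hr4
      · have : G.vB j ^ 2 ≤ r ^ 4 * G.vA j ^ 2 := by
          calc _ ≤ (r ^ 2 * G.vA j) ^ 2 := pow_le_pow_left₀ hB.le (hBA j) 2
            _ = _ := by ring
        have h2 : r ^ 4 * G.vA j ^ 2 ≤ r ^ 4 * (1 / γ ^ 2 * G.vA j ^ 2) := by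
          gcongr
          refine le_mul_of_one_le_left (sq_nonneg _) ?_
          rw [one_le_div (by positivity)]
          exact pow_le_one₀ hγ.le h1
        calc G.vB j = G.vB j ^ 2 / G.vB j := by field_simp
          _ ≤ r ^ 4 * (1 / γ ^ 2 * G.vA j ^ 2) / G.vB j := by gcongr; exact this.trans h2
          _ = _ := by ring
    have hlB := G.lambdaB_pos hγ
    refine (endpoint_le_div_lambdaB h i).trans ?_
    rw [div_le_iff₀ hlB]
    calc G.vB i ≤ r / n * 1 := by simpa using hvB
      _ ≤ r / n * (r ^ 4 * (2 * XA * G.lambdaB γ)) := by gcongr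
      _ ≤ r / n * (r ^ 4 * (2 * XB * G.lambdaB γ)) := by gcongr; exact G.XA_le_XB
      _ = _ := by ring

theorem isProbabilityMeasure_distA (h : γ ∈ G.solutions) (i : Fin n) :
    IsProbabilityMeasure (G.distA γ i) := by
  rw [distA_eq]
  exact uniformType_isProbabilityMeasure (atomA_mem_Icc h i).1 (atomA_mem_Icc h i).2
    (endpoint_pos h i)

theorem isProbabilityMeasure_distB (h : γ ∈ G.solutions) (i : Fin n) :
    IsProbabilityMeasure (G.distB γ i) := by
  rw [distB_eq]
  exact uniformType_isProbabilityMeasure (atomB_mem_Icc h i).1 (atomB_mem_Icc h i).2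
    (endpoint_pos h i)

theorem noLargeGain_of_endpoint_le {K η ε : ℝ}
    (hend : ∀ γ ∈ G.solutions, ∀ i, G.endpoint γ i ≤ K / n) (hη0 : 0 < η) (hη1 : η < 1)
    (hε : 2 * η + 6 * Real.exp (-(2 * n * (η * XA) ^ 2 / K ^ 2)) ≤ ε) : G.NoLargeGain ε := by
  intro γ h
  have hXA := G.XA_pos
  have hXB := G.XB_pos
  have hA0 := fun i => (atomA_mem_Icc h i).1
  have hA1 := fun i => (atomA_mem_Icc h i).2
  have hB0 := fun i => (atomB_mem_Icc h i).1
  have hB1 := fun i => (atomB_mem_Icc h i).2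
  have hE := endpoint_pos h
  have := isProbabilityMeasure_distA h
  have := isProbabilityMeasure_distB h
  have : IsProbabilityMeasure (G.IUA γ) :=
    Measure.isProbabilityMeasure_map (measurable_rescale XA).aemeasurable
  set τ := 2 * Real.exp (-(2 * n * (η * XA) ^ 2 / K ^ 2)) with hτ
  have hτA := pi_uniformType_real_abs_sum_sub_ge G.n_pos hA0 hA1 hE (hend γ h)
    (sum_mean_distA h) (mul_nonneg hη0.le hXA.le)
  -- B's absolute tolerance `η * XB` is at least `η * XA`, so A's failure bound covers both players.
  have hτB : _ ≤ τ := (pi_uniformType_real_abs_sum_sub_ge G.n_pos hB0 hB1 hE (hend γ h)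
    (sum_mean_distB h) (mul_nonneg hη0.le hXB.le)).trans (by
      rw [hτ]
      have := G.XA_le_XB
      gcongr)
  have hε' : 2 * η + 3 * τ ≤ ε := by linarith
  constructor
  · intro x hx
    rw [expPayoffA_eq, expPayoffA_eq, IUA, IUB,
      integral_wonValue_dirac_prod_map _ _ _ (measurable_rescale XB),
      integral_wonValue_map_prod_map _ _ (measurable_rescale XA) (measurable_rescale XB),
      distA_eq, distB_eq]
    refine (integral_wonValue_rescale_le_add (fun i => (G.wA_pos i).le) G.α_nonneg G.α_le_one
      hA0 hA1 hB0 hB1 atomA_eq_zero_or hE (mul_pos G.totalA_pos (G.lambdaA_pos h.1)).le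
      (wA_mul_density h) hXA hXB (sum_mean_distA h) hη0 hη1 hτA hτB hx).trans ?_
    exact add_le_add_right (mul_le_mul_of_nonneg_right hε' G.totalA_pos.le) _
  · intro y hy
    have : IsProbabilityMeasure (G.IUB γ) :=
      Measure.isProbabilityMeasure_map (measurable_rescale XB).aemeasurable
    rw [expPayoffB_eq, expPayoffB_eq, IUA, IUB,
      integral_wonValue_dirac_prod_map _ _ _ (measurable_rescale XA),
      integral_wonValue_map_prod_map _ _ (measurable_rescale XB) (measurable_rescale XA),
      distA_eq, distB_eq]
    refine (integral_wonValue_rescale_le_add (fun i => (G.wB_pos i).le)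
      (sub_nonneg.2 G.α_le_one) (sub_le_self 1 G.α_nonneg)
      hB0 hB1 hA0 hA1 (fun i => (atomA_eq_zero_or i).symm) hE
      (mul_pos G.totalB_pos (G.lambdaB_pos h.1)).le
      (wB_mul_density h) hXB hXA (sum_mean_distB h) hη0 hη1 hτB hτA hy).trans ?_
    exact add_le_add_right (mul_le_mul_of_nonneg_right hε' G.totalB_pos.le) _

/-- Payoffs lie between `0` and the total value. This disposes of `η ≥ 1`, where the rescaling
estimates are unavailable. -/
theorem noLargeGain_of_one_le {ε : ℝ} (hε : 1 ≤ ε) : G.NoLargeGain ε := by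
  intro γ h
  have := isProbabilityMeasure_distA h
  have := isProbabilityMeasure_distB h
  have : IsProbabilityMeasure (G.IUA γ) :=
    Measure.isProbabilityMeasure_map (measurable_rescale XA).aemeasurable
  have : IsProbabilityMeasure (G.IUB γ) :=
    Measure.isProbabilityMeasure_map (measurable_rescale XB).aemeasurable
  have key : ∀ (w : Fin n → ℝ) (α : ℝ), (∀ i, 0 ≤ w i) → 0 ≤ α → α ≤ 1 →
      ∀ (s s' t t' : Measure (Fin n → ℝ)) [IsProbabilityMeasure s] [IsProbabilityMeasure s']
        [IsProbabilityMeasure t] [IsProbabilityMeasure t'],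
        ∫ z, wonValue w α z.1 z.2 ∂(s.prod t) ≤
          ∫ z, wonValue w α z.1 z.2 ∂(s'.prod t') + ε * ∑ i, w i := by
    intro w α hw h0 h1 s s' t t' _ _ _ _
    have hu : ∫ z, wonValue w α z.1 z.2 ∂(s.prod t) ≤ ∫ _, ∑ i, w i ∂(s.prod t) :=
      integral_mono (integrable_wonValue hw h0 h1 measurable_fst measurable_snd)
        (integrable_const _) fun z => wonValue_le hw h1 _ _
    have hl : 0 ≤ ∫ z, wonValue w α z.1 z.2 ∂(s'.prod t') :=
      integral_nonneg fun z => wonValue_nonneg hw h0 _ _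
    rw [integral_const, probReal_univ, one_smul] at hu
    have := le_mul_of_one_le_left (Finset.sum_nonneg fun i (_ : i ∈ Finset.univ) => hw i) hε
    linarith
  refine ⟨fun x _ => ?_, fun y _ => ?_⟩
  · rw [expPayoffA_eq, expPayoffA_eq]
    exact key _ _ (fun i => (G.wA_pos i).le) G.α_nonneg G.α_le_one _ _ _ _
  · rw [expPayoffB_eq, expPayoffB_eq]
    exact key _ _ (fun i => (G.wB_pos i).le) (sub_nonneg.2 G.α_le_one)
      (sub_le_self 1 G.α_nonneg) _ _ _ _

/-- A bound on the gain with a constant that depends only on the budgets and the range of the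
battlefield values. -/
theorem exists_noLargeGain_bound (hXA : 0 < XA) (hXB : XA ≤ XB) (hlo : 0 < wlo)
    (hw : wlo ≤ whi) : ∃ M : ℝ, 0 < M ∧ ∀ (n : ℕ) (G : GCBGame n XA XB),
      G.ValuesWithin wlo whi → ∀ η ε : ℝ, 0 < η →
        2 * η + 6 * Real.exp (-(n * η ^ 2 / M)) ≤ ε → G.NoLargeGain ε := by
  have hr : 0 < whi / wlo := div_pos (hlo.trans_le hw) hlo
  have hXB0 : 0 < XB := hXA.trans_le hXB
  set K := 2 * XB * (whi / wlo) ^ 5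
  have hK : 0 < K := by positivity
  refine ⟨K ^ 2 / (2 * XA ^ 2), by positivity, fun n G hG η ε hη hε => ?_⟩
  rcases lt_or_ge η 1 with h1 | h1
  · refine noLargeGain_of_endpoint_le (K := K) (fun γ h i => endpoint_le hG hlo h i) hη h1
      (hε.trans' ?_)
    refine le_of_eq ?_
    congr 4
    field_simp
  · refine noLargeGain_of_one_le (hε.trans' ?_)
    have := Real.exp_pos (-(n * η ^ 2 / (K ^ 2 / (2 * XA ^ 2))))
    linarith

end GCBGame

/-! ### Asymptotic rate and the choice of the relative error. -/

theorem isSoftO_sqrt_log_div_add {c d : ℝ} :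
    IsSoftO (fun n => c * √(Real.log n / n) + d / (n + 1)) fun n => (n : ℝ) ^ (-(1 / 2) : ℝ) := by
  refine ⟨1, Asymptotics.IsBigO.of_bound (|c| + |d|) ?_⟩
  filter_upwards [Filter.eventually_ge_atTop 3] with n hn
  have hn3 : (3 : ℝ) ≤ n := by exact_mod_cast hn
  have hlog : 1 ≤ Real.log n := by
    rw [Real.le_log_iff_exp_le (by linarith)]
    linarith [Real.exp_one_lt_d9]
  have hs : 0 < √(n : ℝ) := Real.sqrt_pos.2 (by linarith)
  have hs1 : √(n : ℝ) ≤ n := Real.sqrt_le_iff.2 ⟨by linarith, by nlinarith⟩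
  have h1 : √(Real.log n / n) ≤ (√(n : ℝ))⁻¹ * Real.log n := by
    rw [Real.sqrt_div (by linarith), div_eq_inv_mul]
    gcongr
    exact Real.sqrt_le_iff.2 ⟨by linarith, by nlinarith⟩
  have h2 : 1 / ((n : ℝ) + 1) ≤ (√(n : ℝ))⁻¹ * Real.log n := by
    calc 1 / ((n : ℝ) + 1) ≤ 1 / √(n : ℝ) := by gcongr; linarith
      _ = (√(n : ℝ))⁻¹ * 1 := by simp
      _ ≤ _ := by gcongr
  have h3 : (n : ℝ) ^ (-(1 / 2) : ℝ) = (√(n : ℝ))⁻¹ := by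
    rw [Real.rpow_neg (by linarith), Real.sqrt_eq_rpow]
  rw [h3, pow_one, Real.norm_of_nonneg (mul_nonneg (inv_nonneg.2 hs.le) (by linarith))]
  calc _ ≤ ‖c * √(Real.log n / n)‖ + ‖d / ((n : ℝ) + 1)‖ := norm_add_le _ _
    _ = |c| * √(Real.log n / n) + |d| * (1 / (n + 1)) := by
        rw [norm_mul, norm_div, Real.norm_eq_abs, Real.norm_eq_abs, Real.norm_eq_abs,
          Real.norm_eq_abs, abs_of_nonneg (Real.sqrt_nonneg _),
          abs_of_nonneg (by linarith : (0 : ℝ) ≤ n + 1)]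
        ring
    _ ≤ |c| * ((√(n : ℝ))⁻¹ * Real.log n) + |d| * ((√(n : ℝ))⁻¹ * Real.log n) := by gcongr
    _ = _ := by ring

theorem mainTheorem1 (XA XB wlo whi : ℝ) (hXA : 0 < XA) (hXB : XA ≤ XB)
    (hlo : 0 < wlo) (hw : wlo ≤ whi) :
    (∃ ε : ℕ → ℝ, (∀ n, 0 < ε n) ∧
      IsSoftO ε (fun n => (n : ℝ) ^ (-(1 / 2) : ℝ)) ∧
      ∀ (n : ℕ) (G : GCBGame n XA XB), G.ValuesWithin wlo whi → G.NoLargeGain (ε n)) ∧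
    (∃ C : ℝ, 0 < C ∧ ∀ ε : ℝ, 0 < ε → ε ≤ 1 →
      ∀ (n : ℕ) (G : GCBGame n XA XB), G.ValuesWithin wlo whi →
        C * ε⁻¹ ^ 2 * max 1 (Real.log ε⁻¹) ≤ (n : ℝ) → G.NoLargeGain ε) := by
  obtain ⟨M, hM, key⟩ := GCBGame.exists_noLargeGain_bound hXA hXB hlo hw
  constructor
  -- With `η = √M * √(log n / n)` the exponential is exactly `1 / n`. The remaining `6 / n` is
  -- replaced by the larger `12 / (n + 1)`, which stays positive at `n = 0` as well.
  · refine ⟨fun n => 2 * √M * √(Real.log n / n) + 12 / (n + 1), fun n => by positivity,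
      isSoftO_sqrt_log_div_add, fun n G hG => ?_⟩
    have hn3 : (3 : ℝ) ≤ n := by exact_mod_cast G.three_le
    have hlog : 0 < Real.log n := Real.log_pos (by linarith)
    have hq : 0 < Real.log n / n := div_pos hlog (by linarith)
    refine key n G hG (√M * √(Real.log n / n)) _
      (mul_pos (Real.sqrt_pos.2 hM) (Real.sqrt_pos.2 hq)) ?_
    have hexp : -(n * (√M * √(Real.log n / n)) ^ 2 / M) = -Real.log n := by
      rw [mul_pow, Real.sq_sqrt hM.le, Real.sq_sqrt hq.le]
      field_simp
    rw [hexp, Real.exp_neg, Real.exp_log (by linarith), ← mul_assoc]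
    refine add_le_add_right ?_ _
    rw [← div_eq_mul_inv, div_le_div_iff₀ (by linarith) (by linarith)]
    linarith
  -- With `η = ε / 4` the linear term uses `ε / 2`. The constant `64 = 4 * 4 ^ 2` makes the exponent
  -- at least `4 * m`, of which `3` gives the factor `exp (-3) ≤ 1 / 12` and the rest the factor
  -- `ε`; the exponential term then uses the other `ε / 2`.
  · refine ⟨64 * M, by positivity, fun ε hε0 hε1 n G hG hn => ?_⟩
    refine key n G hG (ε / 4) ε (by positivity) ?_
    set m := max 1 (Real.log ε⁻¹)
    have h1 : 1 ≤ m := le_max_left _ _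
    have h2 : Real.log ε⁻¹ ≤ m := le_max_right _ _
    have h3 : 4 * m ≤ n * (ε / 4) ^ 2 / M := by
      calc 4 * m = 64 * M * ε⁻¹ ^ 2 * m * (ε / 4) ^ 2 / M := by field_simp; norm_num
        _ ≤ _ := by gcongr
    have h4 : Real.exp (-(n * (ε / 4) ^ 2 / M)) ≤ Real.exp (-3) * ε := by
      calc _ ≤ Real.exp (-3 + -Real.log ε⁻¹) := Real.exp_le_exp.2 (by linarith)
        _ = _ := by rw [Real.exp_add, Real.log_inv, neg_neg, Real.exp_log hε0]
    have h5 : Real.exp (-3) ≤ 1 / 12 := by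
      have h : (12 : ℝ) ≤ Real.exp 3 := by
        calc (12 : ℝ) ≤ 2.7 ^ 3 := by norm_num
          _ ≤ Real.exp 1 ^ 3 := by gcongr; linarith [Real.exp_one_gt_d9]
          _ = _ := by rw [← Real.exp_nat_mul]; norm_num
      rw [Real.exp_neg, ← one_div]
      exact one_div_le_one_div_of_le (by norm_num) h
    have h6 := mul_le_mul_of_nonneg_right h5 hε0.le
    linarith
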